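/- Let $\mathbb K$ be a field. A *Hom-Lie algebra* $(L,\alpha_L)$ is a $\mathbb K$-vector space $L$ with a bilinear bracket and a linear map $\alpha_L:L\to L$ such that $[x,x]=0$ (hence $[x,y]=-[y,x]$), $[\alpha_L(x),[y,z]]+[\alpha_L(z),[x,y]]+[\alpha_L(y),[z,x]]=0$ and $\alpha_L[x,y]=[\alpha_L(x),\alpha_L(y)]$ for all $x,y,z\in L$. Homomorphisms are the linear maps preserving brackets and commuting with the maps $\alpha$. $L$ is *perfect* if it is spanned by its brackets. *Tensor product.* A Hom-action of $L$ on $M$ is a bilinear map $(x,m)\mapsto{}^xm$ with ${}^{[x,y]}\alpha_M(m)={}^{\alpha_L(x)}({}^ym)-{}^{\alpha_L(y)}({}^xm)$, ${}^{\alpha_L(x)}[m,m']=[{}^xm,\alpha_M(m')]+[\alpha_M(m),{}^xm']$ and $\alpha_M({}^xm)={}^{\alpha_L(x)}\alpha_M(m)$. Mutual Hom-actions of $M$ and $N$ are compatible if ${}^{({}^mn)}m'=[m',{}^nm]$ and ${}^{({}^nm)}n'=[n',{}^mn]$. In that case $M\star N$ is the quotient of $M\otimes_{\mathbb K}N$ by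 the span of the elements - $[m,m']\otimes\alpha_N(n)-\alpha_M(m)\otimes{}^{m'}n+\alpha_M(m')\otimes{}^mn$, - $\alpha_M(m)\otimes[n,n']-{}^{n'}m\otimes\alpha_N(n)+{}^nm\otimes\alpha_N(n')$, - ${}^nm\otimes{}^mn$, - ${}^nm\otimes{}^{m'}n'+{}^{n'}m'\otimes{}^mn$, - $[{}^nm,{}^{n'}m']\otimes\alpha_N({}^{m''}n'')+[{}^{n'}m',{}^{n''}m'']\otimes\alpha_N({}^mn)+[{}^{n''}m'',{}^nm]\otimes\alpha_N({}^{m'}n')$, where $m,m',m''\in M$ and $n,n',n''\in N$. With $m\star n$ the class of $m\otimes n$, it is a Hom-Lie algebra under $[m\star n,m'\star n']=-({}^nm\star{}^{m'}n')$ and $\alpha(m\star n)=\alpha_M(m)\star\alpha_N(n)$. A Hom-Lie algebra acts on itself, and it and any of its Hom-ideals act on each other, by the bracket; these actions are compatible and are the ones used below. *The algebra $\mathfrak{uce}$ and homology.* For a Hom-Lie algebra $L$ let $d_3:\Lambda^3L\to\Lambda^2L$, $d_3(x\wedge y\wedge z)=-[x,y]\wedge\alpha_L(z)+[x,z]\wedge\alpha_L(y)-[y,z]\wedge\alpha_L(x)$,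 and $\mathfrak{uce}(L)=\Lambda^2L/\operatorname{im}(d_3)$. With $\{x,y\}$ the class of $x\wedge y$, it is a Hom-Lie algebra under $[\{x_1,x_2\},\{y_1,y_2\}]=\{[x_1,x_2],[y_1,y_2]\}$ and $\alpha\{x,y\}=\{\alpha_L(x),\alpha_L(y)\}$. Let $H_2^\alpha(L)$ be the kernel of the homomorphism $u:\mathfrak{uce}(L)\to L$, $\{x,y\}\mapsto[x,y]$; it is the second homology of $L$ with trivial coefficients and a Hom-ideal of $\mathfrak{uce}(L)$. *The map $\eta$.* For a Hom-Lie algebra $G$ put $U=\mathfrak{uce}(G)$ and $Z=H_2^\alpha(G)$. Then $U\star Z$ has a Hom-action on $Z\star U$ with ${}^{l\star n}(m\star k)=-({}^nl\star{}^mk)$. The semi-direct product $(Z\star U)\rtimes(U\star Z)$ is $(Z\star U)\oplus(U\star Z)$ with the bracket $[(s_1,t_1),(s_2,t_2)]=([s_1,s_2]+{}^{\alpha(t_1)}s_2-{}^{\alpha(t_2)}s_1,\,[t_1,t_2])$ and the componentwise $\alpha$. Let $$\eta:(Z\star U)\rtimes(U\star Z)\to U\star U,\qquad \eta(s,t)=\eta_1(s)+\alpha_{U\star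 U}(\eta_2(t)),$$ where $\eta_1:Z\star U\to U\star U$ and $\eta_2:U\star Z\to U\star U$ are induced by the inclusion $Z\subseteq U$. **Corollary.** Let $(G,\alpha_G)$ be a perfect Hom-Lie algebra with $\alpha_G$ surjective, and suppose that $H_2^\alpha(G\star G)\cong\operatorname{im}(\eta)$ as Hom-Lie algebras. Then there is an isomorphism of Hom-Lie algebras $$\mathfrak{uce}(G\star G)\;\cong\;\mathfrak{uce}(G)\star\mathfrak{uce}(G).$$ -/

import Mathlib

open scoped TensorProduct

noncomputable section

namespace HomLie

/-! ### Hom-Lie algebras -/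

/-- A (multiplicative) Hom-Lie algebra over `K`: a vector space with an alternating bilinear
bracket and a bracket-preserving linear endomorphism `α` satisfying the Hom-Jacobi identity.
Skew-symmetry is stated as `[x, x] = 0`; this is equivalent to `[x, y] = -[y, x]` when
`char K ≠ 2` and is the usual convention for Lie algebras in every characteristic. -/
class HomLieAlgebra (K : Type*) (L : Type*) [Field K] [AddCommGroup L] [Module K L] where
  /-- the bracket -/
  bracket : L →ₗ[K] L →ₗ[K] L
  /-- the twisting endomorphism -/
  α : L →ₗ[K] L
  bracket_self : ∀ x : L, bracket x x = 0
  hom_jacobi : ∀ x y z : L,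
    bracket (α x) (bracket y z) + bracket (α z) (bracket x y) + bracket (α y) (bracket z x) = 0
  α_bracket : ∀ x y : L, α (bracket x y) = bracket (α x) (α y)

section Basic

variable (K : Type*) {L L' : Type*} [Field K]
  [AddCommGroup L] [Module K L] [HomLieAlgebra K L]
  [AddCommGroup L'] [Module K L'] [HomLieAlgebra K L']

/-- The bracket `[x, y]` as a bilinear map. -/
abbrev br : L →ₗ[K] L →ₗ[K] L := HomLieAlgebra.bracket

/-- The structural endomorphism. -/
abbrev al : L →ₗ[K] L := HomLieAlgebra.α

theorem br_self (x : L) : br K x x = 0 := HomLieAlgebra.bracket_self x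

theorem br_skew (x y : L) : br K x y = - br K y x := by
  have h := br_self K (x + y)
  simp only [map_add, LinearMap.add_apply, br_self, zero_add, add_zero] at h
  exact eq_neg_of_add_eq_zero_right h

theorem al_br (x y : L) : al K (br K x y) = br K (al K x) (al K y) :=
  HomLieAlgebra.α_bracket x y

theorem jacobi (x y z : L) :
    br K (al K x) (br K y z) + br K (al K z) (br K x y) + br K (al K y) (br K z x) = 0 :=
  HomLieAlgebra.hom_jacobi x y z

/-- `[[x, y], α z] = [α x, [y, z]] - [α y, [x, z]]`. -/
theorem br_br_al (x y z : L) :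
    br K (br K x y) (al K z) = br K (al K x) (br K y z) - br K (al K y) (br K x z) := by
  have h := jacobi K x y z
  rw [br_skew K (al K z), br_skew K z x, map_neg] at h
  rw [sub_eq_add_neg]
  have : br K (al K x) (br K y z) + -br K (al K y) (br K x z)
      - br K (br K x y) (al K z) = 0 := by rw [← h]; abel
  exact (sub_eq_zero.mp this).symm

variable (L) in
/-- `L` is perfect if `L = [L, L]`, the subspace spanned by all brackets. -/
def IsPerfect : Prop :=
  Submodule.span K {z : L | ∃ x y : L, z = br K x y} = ⊤

variable (L L') in
/-- Homomorphisms of Hom-Lie algebras. -/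
structure Hom extends L →ₗ[K] L' where
  map_br : ∀ x y : L, toLinearMap (br K x y) = br K (toLinearMap x) (toLinearMap y)
  map_al : ∀ x : L, toLinearMap (al K x) = al K (toLinearMap x)

variable (L L') in
/-- Isomorphisms of Hom-Lie algebras: bijective homomorphisms. -/
structure Iso extends L ≃ₗ[K] L' where
  map_br : ∀ x y : L, toLinearEquiv (br K x y) = br K (toLinearEquiv x) (toLinearEquiv y)
  map_al : ∀ x : L, toLinearEquiv (al K x) = al K (toLinearEquiv x)

variable (L) in
/-- The identity homomorphism. -/
def Hom.id : Hom K L L where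
  toLinearMap := LinearMap.id
  map_br _ _ := rfl
  map_al _ := rfl

variable (L) in
/-- Hom-Lie subalgebras: subspaces closed under the bracket and under `α`. -/
structure Subalgebra extends Submodule K L where
  br_mem : ∀ {x y : L}, x ∈ toSubmodule → y ∈ toSubmodule → br K x y ∈ toSubmodule
  al_mem : ∀ {x : L}, x ∈ toSubmodule → al K x ∈ toSubmodule

variable (L) in
/-- Hom-ideals: Hom-Lie subalgebras `H` with `[h, x] ∈ H` for all `h ∈ H` and all `x`. -/
structure Ideal extends Subalgebra K L where
  br_mem_left : ∀ {h : L} (x : L), h ∈ toSubmodule → br K h x ∈ toSubmodule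

/-- A Hom-Lie subalgebra with the restricted operations is a Hom-Lie algebra. -/
instance Subalgebra.instHomLieAlgebra (S : Subalgebra K L) :
    HomLieAlgebra K S.toSubmodule where
  bracket := LinearMap.mk₂ K (fun x y => ⟨br K (x : L) (y : L), S.br_mem x.2 y.2⟩)
    (fun _ _ _ => Subtype.ext (by simp)) (fun _ _ _ => Subtype.ext (by simp))
    (fun _ _ _ => Subtype.ext (by simp)) (fun _ _ _ => Subtype.ext (by simp))
  α := (al K).restrict (fun _ hx => S.al_mem hx)
  bracket_self x := Subtype.ext (br_self K (x : L))
  hom_jacobi x y z := Subtype.ext (jacobi K (x : L) y z)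
  α_bracket x y := Subtype.ext (al_br K (x : L) y)

variable {K}

theorem Ideal.br_mem_right (I : Ideal K L) {h : L} (x : L) (hh : h ∈ I.toSubmodule) :
    br K x h ∈ I.toSubmodule := by
  rw [br_skew]
  exact I.toSubmodule.neg_mem (I.br_mem_left x hh)

/-- The inclusion of a Hom-ideal. -/
def Ideal.incl (I : Ideal K L) : Hom K I.toSubmodule L where
  toLinearMap := I.toSubmodule.subtype
  map_br _ _ := rfl
  map_al _ := rfl

/-- The kernel of a homomorphism, a Hom-ideal. -/
def Hom.ker (f : Hom K L L') : Ideal K L where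
  toSubmodule := LinearMap.ker f.toLinearMap
  br_mem {x y} hx hy := by
    rw [LinearMap.mem_ker] at *
    rw [f.map_br, hx, map_zero, LinearMap.zero_apply]
  al_mem {x} hx := by
    rw [LinearMap.mem_ker] at *
    rw [f.map_al, hx, map_zero]
  br_mem_left {h} x hh := by
    change h ∈ LinearMap.ker f.toLinearMap at hh
    rw [LinearMap.mem_ker] at *
    rw [f.map_br, hh, map_zero, LinearMap.zero_apply]

/-- The image of a homomorphism, a Hom-Lie subalgebra. -/
def Hom.range (f : Hom K L L') : Subalgebra K L' where
  toSubmodule := LinearMap.range f.toLinearMap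
  br_mem := by
    rintro _ _ ⟨x, rfl⟩ ⟨y, rfl⟩
    exact ⟨br K x y, f.map_br x y⟩
  al_mem := by
    rintro _ ⟨x, rfl⟩
    exact ⟨al K x, f.map_al x⟩

end Basic

/-! ### Hom-actions and semi-direct products -/

section Actions

variable (K : Type*) (L M N : Type*) [Field K]
  [AddCommGroup L] [Module K L] [HomLieAlgebra K L]
  [AddCommGroup M] [Module K M] [HomLieAlgebra K M]
  [AddCommGroup N] [Module K N] [HomLieAlgebra K N]

/-- A Hom-action of `L` on `M`; `act x m` is `ˣm`. -/
structure Action where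
  act : L →ₗ[K] M →ₗ[K] M
  br_act : ∀ (x y : L) (m : M),
    act (br K x y) (al K m) = act (al K x) (act y m) - act (al K y) (act x m)
  act_br : ∀ (x : L) (m m' : M),
    act (al K x) (br K m m') = br K (act x m) (al K m') + br K (al K m) (act x m')
  al_act : ∀ (x : L) (m : M), al K (act x m) = act (al K x) (al K m)

/-- A pair of compatible mutual Hom-actions of `M` and `N` on each other. -/
structure CompatibleActions where
  /-- the action of `M` on `N`, `ᵐn` -/
  onN : Action K M N
  /-- the action of `N` on `M`, `ⁿm` -/
  onM : Action K N M
  compat_M : ∀ (m m' : M) (n : N), onM.act (onN.act m n) m' = br K m' (onM.act n m)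
  compat_N : ∀ (m : M) (n n' : N), onN.act (onM.act n m) n' = br K n' (onN.act m n)

/-- `L` and itself, acting on each other by the bracket. -/
def CompatibleActions.self : CompatibleActions K L L where
  onN := ⟨br K, br_br_al K, fun x m m' => by
    have h := br_br_al K x m m'
    rw [h]; abel, al_br K⟩
  onM := ⟨br K, br_br_al K, fun x m m' => by
    have h := br_br_al K x m m'
    rw [h]; abel, al_br K⟩
  compat_M m m' n := by
    rw [br_skew K _ m', br_skew K m n, map_neg, neg_neg]
  compat_N m n n' := by
    rw [br_skew K _ n', br_skew K n m, map_neg, neg_neg]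

variable {K L M N}

/-- The action of `L` on a Hom-ideal by the bracket of `L`. -/
def Action.onIdeal (I : Ideal K L) : Action K L I.toSubmodule where
  act := LinearMap.mk₂ K (fun x m => ⟨br K x (m : L), I.br_mem_right x m.2⟩)
    (fun _ _ _ => Subtype.ext (by simp)) (fun _ _ _ => Subtype.ext (by simp))
    (fun _ _ _ => Subtype.ext (by simp)) (fun _ _ _ => Subtype.ext (by simp))
  br_act x y m := Subtype.ext ((CompatibleActions.self K L).onN.br_act x y m)
  act_br x m m' := Subtype.ext ((CompatibleActions.self K L).onN.act_br x m m')
  al_act x m := Subtype.ext (al_br K x (m : L))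

/-- The action of a Hom-ideal on `L` by the bracket of `L`. -/
def Action.ofIdeal (I : Ideal K L) : Action K I.toSubmodule L where
  act := (br K).comp I.toSubmodule.subtype
  br_act x y m := (CompatibleActions.self K L).onN.br_act (x : L) (y : L) m
  act_br x m m' := (CompatibleActions.self K L).onN.act_br (x : L) m m'
  al_act x m := al_br K (x : L) m

/-- A Hom-ideal `I` and `L`, acting on each other by the bracket. -/
def CompatibleActions.idealLeft (I : Ideal K L) : CompatibleActions K I.toSubmodule L where
  onN := Action.ofIdeal I
  onM := Action.onIdeal I
  compat_M m m' n := Subtype.ext ((CompatibleActions.self K L).compat_M (m : L) (m' : L) n)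
  compat_N m n n' := (CompatibleActions.self K L).compat_N (m : L) n n'

/-- `L` and a Hom-ideal `I`, acting on each other by the bracket. -/
def CompatibleActions.idealRight (I : Ideal K L) : CompatibleActions K L I.toSubmodule where
  onN := Action.onIdeal I
  onM := Action.ofIdeal I
  compat_M m m' n := (CompatibleActions.self K L).compat_M m m' (n : L)
  compat_N m n n' := Subtype.ext ((CompatibleActions.self K L).compat_N m (n : L) (n' : L))

/-- The underlying space `M ⊕ L` of the semi-direct product `M ⋊ L`. -/
def SemiDirect (_A : Action K L M) : Type _ := M × L

namespace SemiDirect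

variable (A : Action K L M)

instance : AddCommGroup (SemiDirect A) := inferInstanceAs (AddCommGroup (M × L))
instance : Module K (SemiDirect A) := inferInstanceAs (Module K (M × L))

/-- `[(m₁, x₁), (m₂, x₂)] = ([m₁, m₂] + ^{α x₁} m₂ - ^{α x₂} m₁, [x₁, x₂])`. -/
def prodBracket : M × L →ₗ[K] M × L →ₗ[K] M × L :=
  LinearMap.mk₂ K
    (fun p q : M × L =>
      (br K p.1 q.1 + A.act (al K p.2) q.1 - A.act (al K q.2) p.1, br K p.2 q.2))
    (fun p p' q => Prod.ext (by simp; abel) (by simp))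
    (fun c p q => Prod.ext (by simp [smul_sub]) (by simp))
    (fun p p' q => Prod.ext (by simp; abel) (by simp))
    (fun c p q => Prod.ext (by simp [smul_sub]) (by simp))

/-- The semi-direct product `M ⋊ L`, with `α (m, x) = (α m, α x)`. -/
instance : HomLieAlgebra K (SemiDirect A) where
  bracket := prodBracket A
  α := (al K : M →ₗ[K] M).prodMap (al K : L →ₗ[K] L)
  bracket_self p := by
    change ((br K p.1 p.1 + A.act (al K p.2) p.1 - A.act (al K p.2) p.1, br K p.2 p.2) : M × L) = 0
    rw [br_self, br_self, zero_add, sub_self]; rfl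
  hom_jacobi := by
    rintro ⟨m₁, x₁⟩ ⟨m₂, x₂⟩ ⟨m₃, x₃⟩
    refine Prod.ext ?_ (jacobi K x₁ x₂ x₃)
    change (br K (al K m₁) (br K m₂ m₃ + A.act (al K x₂) m₃ - A.act (al K x₃) m₂)
        + A.act (al K (al K x₁)) (br K m₂ m₃ + A.act (al K x₂) m₃ - A.act (al K x₃) m₂)
        - A.act (al K (br K x₂ x₃)) (al K m₁))
      + (br K (al K m₃) (br K m₁ m₂ + A.act (al K x₁) m₂ - A.act (al K x₂) m₁)
        + A.act (al K (al K x₃)) (br K m₁ m₂ + A.act (al K x₁) m₂ - A.act (al K x₂) m₁)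
        - A.act (al K (br K x₁ x₂)) (al K m₃))
      + (br K (al K m₂) (br K m₃ m₁ + A.act (al K x₃) m₁ - A.act (al K x₁) m₃)
        + A.act (al K (al K x₂)) (br K m₃ m₁ + A.act (al K x₃) m₁ - A.act (al K x₁) m₃)
        - A.act (al K (br K x₃ x₁)) (al K m₂)) = 0
    simp only [al_br, A.br_act, map_add, map_sub, A.act_br]
    have hj := jacobi K m₁ m₂ m₃
    rw [br_skew K (A.act (al K x₁) m₂), br_skew K (A.act (al K x₂) m₃),
      br_skew K (A.act (al K x₃) m₁)]
    rw [← hj]; abel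
  α_bracket := by
    rintro ⟨m₁, x₁⟩ ⟨m₂, x₂⟩
    refine Prod.ext ?_ (al_br K x₁ x₂)
    change al K (br K m₁ m₂ + A.act (al K x₁) m₂ - A.act (al K x₂) m₁)
      = br K (al K m₁) (al K m₂) + A.act (al K (al K x₁)) (al K m₂)
        - A.act (al K (al K x₂)) (al K m₁)
    simp only [map_add, map_sub, al_br, A.al_act]

end SemiDirect

end Actions

/-! ### The non-abelian tensor product -/

section Tensor

variable {K : Type*} {M N : Type*} [Field K]
  [AddCommGroup M] [Module K M] [HomLieAlgebra K M]
  [AddCommGroup N] [Module K N] [HomLieAlgebra K N]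

/-- The elements of `M ⊗ N` that span the defining relations of `M ⋆ N`. -/
inductive StarRel (A : CompatibleActions K M N) : M ⊗[K] N → Prop
  | i (m m' : M) (n : N) : StarRel A
      (br K m m' ⊗ₜ al K n - al K m ⊗ₜ A.onN.act m' n + al K m' ⊗ₜ A.onN.act m n)
  | ii (m : M) (n n' : N) : StarRel A
      (al K m ⊗ₜ br K n n' - A.onM.act n' m ⊗ₜ al K n + A.onM.act n m ⊗ₜ al K n')
  | iii (m : M) (n : N) : StarRel A (A.onM.act n m ⊗ₜ A.onN.act m n)
  | iv (m m' : M) (n n' : N) : StarRel A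
      (A.onM.act n m ⊗ₜ A.onN.act m' n' + A.onM.act n' m' ⊗ₜ A.onN.act m n)
  | v (m m' m'' : M) (n n' n'' : N) : StarRel A
      (br K (A.onM.act n m) (A.onM.act n' m') ⊗ₜ al K (A.onN.act m'' n'')
        + br K (A.onM.act n' m') (A.onM.act n'' m'') ⊗ₜ al K (A.onN.act m n)
        + br K (A.onM.act n'' m'') (A.onM.act n m) ⊗ₜ al K (A.onN.act m' n'))

/-- The non-abelian tensor product `M ⋆ N`: the quotient of `M ⊗ N` by the relations. -/
def Star (A : CompatibleActions K M N) : Type _ :=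
  (M ⊗[K] N) ⧸ Submodule.span K {t | StarRel A t}

namespace Star

variable (A : CompatibleActions K M N)

instance : AddCommGroup (Star A) :=
  inferInstanceAs (AddCommGroup ((M ⊗[K] N) ⧸ Submodule.span K {t | StarRel A t}))
instance : Module K (Star A) :=
  inferInstanceAs (Module K ((M ⊗[K] N) ⧸ Submodule.span K {t | StarRel A t}))

/-- The quotient map `M ⊗ N → M ⋆ N`. -/
def proj : M ⊗[K] N →ₗ[K] Star A := Submodule.mkQ _

/-- `m ⋆ n`, as a bilinear map. -/
def mk : M →ₗ[K] N →ₗ[K] Star A := (TensorProduct.mk K M N).compr₂ (proj A)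

variable {A}

theorem proj_eq_zero {t : M ⊗[K] N} (h : StarRel A t) : proj A t = 0 :=
  (Submodule.Quotient.mk_eq_zero _).2 (Submodule.subset_span h)

@[elab_as_elim]
theorem ind {P : Star A → Prop} (t : Star A) (zero : P 0) (mk : ∀ m n, P (mk A m n))
    (add : ∀ s t, P s → P t → P (s + t)) : P t := by
  obtain ⟨t, rfl⟩ := Submodule.mkQ_surjective _ t
  induction t using TensorProduct.induction_on with
  | zero => rw [map_zero]; exact zero
  | tmul m n => exact mk m n
  | add x y hx hy => rw [map_add]; exact add _ _ hx hy

/-- Linear maps out of `M ⋆ N`, from bilinear maps that respect the relations. -/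
def lift {P : Type*} [AddCommGroup P] [Module K P] (h : M →ₗ[K] N →ₗ[K] P)
    (hh : ∀ t, StarRel A t → TensorProduct.lift h t = 0) : Star A →ₗ[K] P :=
  Submodule.liftQ _ (TensorProduct.lift h) (Submodule.span_le.2 fun t ht => hh t ht)

@[simp] theorem lift_mk {P : Type*} [AddCommGroup P] [Module K P] (h : M →ₗ[K] N →ₗ[K] P)
    (hh : ∀ t, StarRel A t → TensorProduct.lift h t = 0) (m : M) (n : N) :
    lift h hh (mk A m n) = h m n := by
  change TensorProduct.lift h (m ⊗ₜ n) = h m n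
  rw [TensorProduct.lift.tmul]

theorem rel_i (m m' : M) (n : N) :
    mk A (br K m m') (al K n) - mk A (al K m) (A.onN.act m' n)
      + mk A (al K m') (A.onN.act m n) = 0 := by
  simpa [mk] using proj_eq_zero (StarRel.i (A := A) m m' n)

theorem rel_ii (m : M) (n n' : N) :
    mk A (al K m) (br K n n') - mk A (A.onM.act n' m) (al K n)
      + mk A (A.onM.act n m) (al K n') = 0 := by
  simpa [mk] using proj_eq_zero (StarRel.ii (A := A) m n n')

theorem rel_iii (m : M) (n : N) : mk A (A.onM.act n m) (A.onN.act m n) = 0 := by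
  simpa [mk] using proj_eq_zero (StarRel.iii (A := A) m n)

theorem rel_iv (m m' : M) (n n' : N) :
    mk A (A.onM.act n m) (A.onN.act m' n') + mk A (A.onM.act n' m') (A.onN.act m n) = 0 := by
  simpa [mk] using proj_eq_zero (StarRel.iv (A := A) m m' n n')

theorem rel_v (m m' m'' : M) (n n' n'' : N) :
    mk A (br K (A.onM.act n m) (A.onM.act n' m')) (al K (A.onN.act m'' n''))
        + mk A (br K (A.onM.act n' m') (A.onM.act n'' m'')) (al K (A.onN.act m n))
        + mk A (br K (A.onM.act n'' m'') (A.onM.act n m)) (al K (A.onN.act m' n')) = 0 := by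
  simpa [mk] using proj_eq_zero (StarRel.v (A := A) m m' m'' n n' n'')

variable (A)

/-- The linear map `M ⋆ N → M`, `m ⋆ n ↦ -ⁿm`. -/
def toM : Star A →ₗ[K] M := lift (-A.onM.act.flip) (by
  rintro _ (⟨m, m', n⟩ | ⟨m, n, n'⟩ | ⟨m, n⟩ | ⟨m, m', n, n'⟩ | ⟨m, m', m'', n, n', n''⟩) <;>
    simp only [map_add, map_sub, TensorProduct.lift.tmul, LinearMap.neg_apply,
      LinearMap.flip_apply, A.onM.br_act, A.onM.act_br, A.compat_M, A.onN.al_act]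
  · rw [br_skew K (A.onM.act n m)]; abel
  · abel
  · rw [br_self, neg_zero]
  · rw [br_skew K (A.onM.act n m)]; abel
  · have h := jacobi K (A.onM.act n m) (A.onM.act n' m') (A.onM.act n'' m'')
    simp only [← A.onM.al_act]
    rw [br_skew K (br K (A.onM.act n m) _), br_skew K (br K (A.onM.act n' m') _),
      br_skew K (br K (A.onM.act n'' m'') _)]
    rw [← h]; abel)

/-- The linear map `M ⋆ N → N`, `m ⋆ n ↦ ᵐn`. -/
def toN : Star A →ₗ[K] N := lift A.onN.act (by
  rintro _ (⟨m, m', n⟩ | ⟨m, n, n'⟩ | ⟨m, n⟩ | ⟨m, m', n, n'⟩ | ⟨m, m', m'', n, n', n''⟩) <;>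
    simp only [map_add, map_sub, TensorProduct.lift.tmul, A.onN.br_act, A.onN.act_br,
      A.compat_N]
  · abel
  · rw [br_skew K (A.onN.act m n)]; abel
  · rw [br_self]
  · rw [br_skew K (A.onN.act m n)]; abel
  · have h := jacobi K (A.onN.act m n) (A.onN.act m' n') (A.onN.act m'' n'')
    generalize A.onN.act m n = x at *
    generalize A.onN.act m' n' = y at *
    generalize A.onN.act m'' n'' = z at *
    rw [br_skew K z y, br_skew K y x, br_skew K x z]
    simp only [map_neg, LinearMap.neg_apply]
    rw [br_skew K (br K y z), br_skew K (br K x y), br_skew K (br K z x)]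
    have h2 : (-4 : ℤ) • (br K (al K x) (br K y z) + br K (al K z) (br K x y)
      + br K (al K y) (br K z x)) = 0 := by rw [h, smul_zero]
    rw [← h2]; abel)

@[simp] theorem toM_mk (m : M) (n : N) : toM A (mk A m n) = -A.onM.act n m := lift_mk _ _ m n

@[simp] theorem toN_mk (m : M) (n : N) : toN A (mk A m n) = A.onN.act m n := lift_mk _ _ m n

/-- The endomorphism of `M ⋆ N`, `m ⋆ n ↦ α m ⋆ α n`. -/
def alpha : Star A →ₗ[K] Star A := lift ((mk A).compl₁₂ (al K) (al K)) (by
  rintro _ (⟨m, m', n⟩ | ⟨m, n, n'⟩ | ⟨m, n⟩ | ⟨m, m', n, n'⟩ | ⟨m, m', m'', n, n', n''⟩) <;>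
    simp only [map_add, map_sub, TensorProduct.lift.tmul, LinearMap.compl₁₂_apply, al_br,
      A.onM.al_act, A.onN.al_act]
  · exact rel_i _ _ _
  · exact rel_ii _ _ _
  · exact rel_iii _ _
  · exact rel_iv _ _ _ _
  · simp only [← A.onN.al_act (al K _)]
    exact rel_v _ _ _ _ _ _)

@[simp] theorem alpha_mk (m : M) (n : N) : alpha A (mk A m n) = mk A (al K m) (al K n) :=
  lift_mk _ _ m n

/-- The bracket of `M ⋆ N`, `[m ⋆ n, m' ⋆ n'] = -(ⁿm ⋆ ᵐ'n')`. -/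
def bracket : Star A →ₗ[K] Star A →ₗ[K] Star A := (mk A).compl₁₂ (toM A) (toN A)

theorem bracket_apply (s t : Star A) : bracket A s t = mk A (toM A s) (toN A t) := rfl

theorem bracket_mk (m m' : M) (n n' : N) :
    bracket A (mk A m n) (mk A m' n') = -mk A (A.onM.act n m) (A.onN.act m' n') := by
  simp [bracket_apply]

theorem bracket_skew (s t : Star A) : bracket A s t = -bracket A t s := by
  induction s using ind with
  | zero => simp
  | add x y hx hy => rw [map_add, LinearMap.add_apply, hx, hy, map_add]; abel
  | mk m n =>
    induction t using ind with
    | zero => simp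
    | add x y hx hy => rw [map_add, hx, hy, map_add, LinearMap.add_apply]; abel
    | mk m' n' =>
      rw [bracket_mk, bracket_mk, neg_neg, neg_eq_iff_add_eq_zero]
      exact rel_iv m m' n n'

theorem bracket_self (s : Star A) : bracket A s s = 0 := by
  induction s using ind with
  | zero => simp
  | mk m n => rw [bracket_mk, rel_iii, neg_zero]
  | add x y hx hy =>
    rw [map_add, map_add, LinearMap.add_apply, LinearMap.add_apply, hx, hy, bracket_skew A y x]
    abel

theorem toM_alpha (s : Star A) : toM A (alpha A s) = al K (toM A s) := by
  induction s using ind with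
  | zero => simp
  | mk m n => simp [A.onM.al_act]
  | add x y hx hy => simp only [map_add, hx, hy]

theorem toN_alpha (s : Star A) : toN A (alpha A s) = al K (toN A s) := by
  induction s using ind with
  | zero => simp
  | mk m n => simp [A.onN.al_act]
  | add x y hx hy => simp only [map_add, hx, hy]

theorem toM_bracket (s t : Star A) : toM A (bracket A s t) = br K (toM A s) (toM A t) := by
  induction t using ind with
  | zero => simp
  | add x y hx hy => simp only [map_add, hx, hy]
  | mk m n =>
    rw [bracket_apply, toM_mk, toN_mk, toM_mk, A.compat_M, map_neg]

theorem toN_bracket (s t : Star A) : toN A (bracket A s t) = br K (toN A s) (toN A t) := by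
  induction s using ind with
  | zero => simp
  | add x y hx hy => simp only [map_add, LinearMap.add_apply, hx, hy]
  | mk m n =>
    rw [bracket_apply, toM_mk, toN_mk, toN_mk, map_neg, LinearMap.neg_apply, A.compat_N,
      br_skew K (A.onN.act m n)]

theorem bracket_jacobi (s t r : Star A) :
    bracket A (bracket A s t) (alpha A r) + bracket A (bracket A t r) (alpha A s)
      + bracket A (bracket A r s) (alpha A t) = 0 := by
  simp only [bracket_apply A (bracket A _ _), toM_bracket, toN_alpha]
  induction s using ind with
  | zero => simp
  | add x y hx hy =>
    simp only [map_add, LinearMap.add_apply]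
    refine Eq.trans ?_ ((congrArg₂ (· + ·) hx hy).trans (add_zero 0))
    abel
  | mk m n =>
    induction t using ind with
    | zero => simp
    | add x y hx hy =>
      simp only [map_add, LinearMap.add_apply] at hx hy ⊢
      refine Eq.trans ?_ ((congrArg₂ (· + ·) hx hy).trans (add_zero 0))
      abel
    | mk m' n' =>
      induction r using ind with
      | zero => simp
      | add x y hx hy =>
        simp only [map_add, LinearMap.add_apply] at hx hy ⊢
        refine Eq.trans ?_ ((congrArg₂ (· + ·) hx hy).trans (add_zero 0))
        abel
      | mk m'' n'' =>
        simp only [toM_mk, toN_mk, map_neg, LinearMap.neg_apply, neg_neg]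
        exact rel_v m m' m'' n n' n''

/-- `M ⋆ N` is a Hom-Lie algebra. -/
instance : HomLieAlgebra K (Star A) where
  bracket := bracket A
  α := alpha A
  bracket_self := bracket_self A
  hom_jacobi s t r := by
    rw [bracket_skew A (alpha A s), bracket_skew A (alpha A t), bracket_skew A (alpha A r)]
    have h := bracket_jacobi A s t r
    rw [← neg_eq_zero, ← h]; abel
  α_bracket s t := by
    rw [bracket_apply, bracket_apply, alpha_mk, toM_alpha, toN_alpha]

theorem br_def (s t : Star A) : br K s t = mk A (toM A s) (toN A t) := rfl

theorem al_def (s : Star A) : al K s = alpha A s := rfl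

end Star

section Functoriality

variable {M' N' : Type*}
  [AddCommGroup M'] [Module K M'] [HomLieAlgebra K M']
  [AddCommGroup N'] [Module K N'] [HomLieAlgebra K N']

variable {A : CompatibleActions K M N} {A' : CompatibleActions K M' N'}

/-- The underlying linear map of `f ⋆ g`. -/
def Star.mapLin (f : Hom K M M') (g : Hom K N N')
    (hf : ∀ (n : N) (m : M), f.toLinearMap (A.onM.act n m)
      = A'.onM.act (g.toLinearMap n) (f.toLinearMap m))
    (hg : ∀ (m : M) (n : N), g.toLinearMap (A.onN.act m n)
      = A'.onN.act (f.toLinearMap m) (g.toLinearMap n)) :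
    Star A →ₗ[K] Star A' :=
  Star.lift ((Star.mk A').compl₁₂ f.toLinearMap g.toLinearMap) (by
    rintro _ (⟨m, m', n⟩ | ⟨m, n, n'⟩ | ⟨m, n⟩ | ⟨m, m', n, n'⟩ | ⟨m, m', m'', n, n', n''⟩) <;>
      simp only [map_add, map_sub, TensorProduct.lift.tmul, LinearMap.compl₁₂_apply,
        f.map_br, f.map_al, g.map_br, g.map_al, hf, hg]
    · exact Star.rel_i _ _ _
    · exact Star.rel_ii _ _ _
    · exact Star.rel_iii _ _
    · exact Star.rel_iv _ _ _ _
    · exact Star.rel_v _ _ _ _ _ _)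

theorem Star.mapLin_mk (f : Hom K M M') (g : Hom K N N')
    (hf : ∀ (n : N) (m : M), f.toLinearMap (A.onM.act n m)
      = A'.onM.act (g.toLinearMap n) (f.toLinearMap m))
    (hg : ∀ (m : M) (n : N), g.toLinearMap (A.onN.act m n)
      = A'.onN.act (f.toLinearMap m) (g.toLinearMap n)) (m : M) (n : N) :
    Star.mapLin f g hf hg (Star.mk A m n)
      = Star.mk A' (f.toLinearMap m) (g.toLinearMap n) :=
  Star.lift_mk _ _ m n

/-- The homomorphism `f ⋆ g : M ⋆ N → M' ⋆ N'`, `m ⋆ n ↦ f m ⋆ g n`, for homomorphisms `f`, `g`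
that preserve the actions. -/
def Star.map (f : Hom K M M') (g : Hom K N N')
    (hf : ∀ (n : N) (m : M), f.toLinearMap (A.onM.act n m)
      = A'.onM.act (g.toLinearMap n) (f.toLinearMap m))
    (hg : ∀ (m : M) (n : N), g.toLinearMap (A.onN.act m n)
      = A'.onN.act (f.toLinearMap m) (g.toLinearMap n)) :
    Hom K (Star A) (Star A') where
  toLinearMap := Star.mapLin f g hf hg
  map_br s t := by
    have hM : Star.toM A' (Star.mapLin f g hf hg s) = f.toLinearMap (Star.toM A s) := by
      induction s using Star.ind with
      | zero => simp
      | mk m n => rw [Star.mapLin_mk, Star.toM_mk, Star.toM_mk, map_neg, hf]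
      | add x y hx hy => simp only [map_add, hx, hy]
    have hN : Star.toN A' (Star.mapLin f g hf hg t) = g.toLinearMap (Star.toN A t) := by
      induction t using Star.ind with
      | zero => simp
      | mk m n => rw [Star.mapLin_mk, Star.toN_mk, Star.toN_mk, hg]
      | add x y hx hy => simp only [map_add, hx, hy]
    rw [Star.br_def, Star.br_def, Star.mapLin_mk, hM, hN]
  map_al s := by
    rw [Star.al_def, Star.al_def]
    induction s using Star.ind with
    | zero => simp
    | mk m n =>
      rw [Star.alpha_mk, Star.mapLin_mk, Star.mapLin_mk, Star.alpha_mk, f.map_al, g.map_al]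
    | add x y hx hy => simp only [map_add, hx, hy]

end Functoriality

end Tensor

/-! ### The homomorphism `η` of a Hom-ideal -/

section Eta

variable {K : Type*} {L : Type*} [Field K] [AddCommGroup L] [Module K L] [HomLieAlgebra K L]

variable (K L) in
/-- The non-abelian tensor square `L ⋆ L`, with `L` acting on itself by the bracket. -/
abbrev Square : Type _ := Star (CompatibleActions.self K L)

/-- `I ⋆ L` for a Hom-ideal `I` of `L`, the actions being given by the bracket of `L`. -/
abbrev StarLeft (I : Ideal K L) : Type _ := Star (CompatibleActions.idealLeft I)

/-- `L ⋆ I` for a Hom-ideal `I` of `L`, the actions being given by the bracket of `L`. -/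
abbrev StarRight (I : Ideal K L) : Type _ := Star (CompatibleActions.idealRight I)

theorem incl_onIdeal (I : Ideal K L) (n : L) (m : I.toSubmodule) :
    I.incl.toLinearMap ((Action.onIdeal I).act n m) = br K n (I.incl.toLinearMap m) := rfl

theorem id_ofIdeal (I : Ideal K L) (m : I.toSubmodule) (n : L) :
    (Hom.id K L).toLinearMap ((Action.ofIdeal I).act m n) = br K (I.incl.toLinearMap m) n := rfl

/-- The homomorphism `i ⋆ id : I ⋆ L → L ⋆ L`. -/
def eta₁ (I : Ideal K L) : Hom K (StarLeft I) (Square K L) :=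
  Star.map I.incl (Hom.id K L) (incl_onIdeal I) (id_ofIdeal I)

/-- The homomorphism `id ⋆ i : L ⋆ I → L ⋆ L`. -/
def eta₂ (I : Ideal K L) : Hom K (StarRight I) (Square K L) :=
  Star.map (Hom.id K L) I.incl (id_ofIdeal I) (incl_onIdeal I)

theorem eta₁_mk (I : Ideal K L) (m : I.toSubmodule) (n : L) :
    (eta₁ I).toLinearMap (Star.mk _ m n) = Star.mk _ (m : L) n :=
  Star.mapLin_mk I.incl (Hom.id K L) (incl_onIdeal I) (id_ofIdeal I) m n

theorem eta₂_mk (I : Ideal K L) (m : L) (n : I.toSubmodule) :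
    (eta₂ I).toLinearMap (Star.mk _ m n) = Star.mk _ m (n : L) :=
  Star.mapLin_mk (Hom.id K L) I.incl (id_ofIdeal I) (incl_onIdeal I) m n

theorem toN_eta₁ (I : Ideal K L) (s : StarLeft I) :
    Star.toN (CompatibleActions.self K L) ((eta₁ I).toLinearMap s)
      = Star.toN (CompatibleActions.idealLeft I) s := by
  induction s using Star.ind with
  | zero => simp
  | mk m n => rw [eta₁_mk, Star.toN_mk, Star.toN_mk]; rfl
  | add x y hx hy => simp only [map_add, hx, hy]

theorem toM_eta₂ (I : Ideal K L) (s : StarRight I) :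
    Star.toM (CompatibleActions.self K L) ((eta₂ I).toLinearMap s)
      = (Star.toN (CompatibleActions.idealRight I) s : I.toSubmodule) := by
  induction s using Star.ind with
  | zero => simp
  | mk m n =>
    rw [eta₂_mk, Star.toN_mk, Star.toM_mk]
    change - br K (n : L) m = br K m (n : L)
    rw [br_skew K m]
  | add x y hx hy => simp only [map_add, hx, hy, Submodule.coe_add]

/-- The Hom-action of `L ⋆ I` on `I ⋆ L` given by `^{l ⋆ n}(m ⋆ k) = -(ⁿl ⋆ ᵐk)`; here
`-ⁿl = [l, n]` is an element of `I`. -/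
def etaAction (I : Ideal K L) : Action K (StarRight I) (StarLeft I) where
  act := (Star.mk (CompatibleActions.idealLeft I)).compl₁₂
    (Star.toN (CompatibleActions.idealRight I)) (Star.toN (CompatibleActions.idealLeft I))
  br_act x y s := by
    simp only [LinearMap.compl₁₂_apply, Star.al_def, Star.toN_alpha, Star.toN_mk]
    have h := Star.rel_i (A := CompatibleActions.idealLeft I)
      (Star.toN _ x) (Star.toN _ y) (Star.toN _ s)
    have hb : Star.toN _ (br K x y) = br K (Star.toN _ x) (Star.toN _ y) :=
      Star.toN_bracket _ x y
    rw [hb, ← sub_eq_zero, ← h]; abel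
  act_br x s s' := by
    have hb : Star.toN _ (br K s s') = br K (Star.toN _ s) (Star.toN _ s') :=
      Star.toN_bracket _ s s'
    rw [br_skew K (al K s)]
    simp only [LinearMap.compl₁₂_apply, Star.al_def, Star.toN_alpha, hb]
    simp only [Star.br_def, Star.toM_mk, Star.toN_alpha]
    have h := Star.rel_ii (A := CompatibleActions.idealLeft I)
      (Star.toN _ x) (Star.toN _ s) (Star.toN _ s')
    simp only [map_neg, LinearMap.neg_apply, neg_neg]
    rw [← sub_eq_zero, ← h]; abel
  al_act x s := by
    simp only [LinearMap.compl₁₂_apply, Star.al_def, Star.toN_alpha, Star.alpha_mk]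

theorem etaAction_mk (I : Ideal K L) (l : L) (n : I.toSubmodule) (m : I.toSubmodule) (k : L) :
    (etaAction I).act (Star.mk _ l n) (Star.mk _ m k)
      = -Star.mk (CompatibleActions.idealLeft I)
          ⟨br K (n : L) l, I.br_mem_left l n.2⟩ (br K (m : L) k) := by
  have h : (⟨br K l (n : L), I.br_mem_right l n.2⟩ : I.toSubmodule)
      = -⟨br K (n : L) l, I.br_mem_left l n.2⟩ := Subtype.ext (br_skew K l (n : L))
  change Star.mk (CompatibleActions.idealLeft I)
    (Star.toN (CompatibleActions.idealRight I) (Star.mk _ l n)) (Star.toN _ (Star.mk _ m k)) = _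
  rw [Star.toN_mk, Star.toN_mk, ← LinearMap.neg_apply, ← map_neg, ← h]
  rfl

/-- The homomorphism `η : (I ⋆ L) ⋊ (L ⋆ I) → L ⋆ L`, `η (s, t) = η₁ s + α (η₂ t)`. -/
def eta (I : Ideal K L) : Hom K (SemiDirect (etaAction I)) (Square K L) where
  toLinearMap := LinearMap.coprod (M := StarLeft I) (M₂ := StarRight I)
    (eta₁ I).toLinearMap ((al K).comp (eta₂ I).toLinearMap)
  map_br := by
    have key (t : StarRight I) (s : StarLeft I) :
        (eta₁ I).toLinearMap ((etaAction I).act t s)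
          = br K ((eta₂ I).toLinearMap t) ((eta₁ I).toLinearMap s) := by
      rw [Star.br_def, toM_eta₂, toN_eta₁]
      exact eta₁_mk I _ _
    rintro ⟨s₁, t₁⟩ ⟨s₂, t₂⟩
    change (eta₁ I).toLinearMap (br K s₁ s₂ + (etaAction I).act (al K t₁) s₂
          - (etaAction I).act (al K t₂) s₁) + al K ((eta₂ I).toLinearMap (br K t₁ t₂))
      = br K ((eta₁ I).toLinearMap s₁ + al K ((eta₂ I).toLinearMap t₁))
          ((eta₁ I).toLinearMap s₂ + al K ((eta₂ I).toLinearMap t₂))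
    simp only [map_add, map_sub, LinearMap.add_apply, key, (eta₁ I).map_br, (eta₂ I).map_br,
      (eta₂ I).map_al, al_br]
    rw [br_skew K ((eta₁ I).toLinearMap s₁) (al K ((eta₂ I).toLinearMap t₂))]
    abel
  map_al := by
    rintro ⟨s, t⟩
    change (eta₁ I).toLinearMap (al K s) + al K ((eta₂ I).toLinearMap (al K t))
      = al K ((eta₁ I).toLinearMap s + al K ((eta₂ I).toLinearMap t))
    rw [(eta₁ I).map_al, (eta₂ I).map_al, map_add]

end Eta

/-! ### Homology and the universal central extension -/

section Wedge

variable (K : Type*) (L : Type*) [Field K] [AddCommGroup L] [Module K L]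

variable {K L} in
/-- The alternating map of two variables given by an alternating bilinear map. -/
def altTwo {P : Type*} [AddCommGroup P] [Module K P] (B : L →ₗ[K] L →ₗ[K] P)
    (hB : ∀ x, B x x = 0) : L [⋀^Fin 2]→ₗ[K] P where
  toFun v := B (v 0) (v 1)
  map_update_add' v i x y := by fin_cases i <;> simp [Function.update]
  map_update_smul' v i c x := by fin_cases i <;> simp [Function.update]
  map_eq_zero_of_eq' v i j h hij := by
    fin_cases i <;> fin_cases j <;> simp_all

/-- `x ∧ y ∈ ⋀² L`, as a bilinear map. -/
def wedge : L →ₗ[K] L →ₗ[K] ⋀[K]^2 L :=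
  LinearMap.mk₂ K (fun x y => exteriorPower.ιMulti K 2 ![x, y])
    (fun x x' y => by
      have h := (exteriorPower.ιMulti K 2).map_update_add ![x, y] 0 x x'
      simpa only [Matrix.vecCons, Fin.update_cons_zero] using h)
    (fun c x y => by
      have h := (exteriorPower.ιMulti K 2).map_update_smul ![x, y] 0 c x
      simpa only [Matrix.vecCons, Fin.update_cons_zero] using h)
    (fun x y y' => by
      have h := (exteriorPower.ιMulti K 2).map_update_add ![x, y] 1 y y'
      have e (z : L) : Function.update ![x, y] 1 z = ![x, z] := by
        ext i; fin_cases i <;> rfl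
      simpa only [e] using h)
    (fun c x y => by
      have h := (exteriorPower.ιMulti K 2).map_update_smul ![x, y] 1 c y
      have e (z : L) : Function.update ![x, y] 1 z = ![x, z] := by
        ext i; fin_cases i <;> rfl
      simpa only [e] using h)

variable {K L} in
theorem wedge_self (x : L) : wedge K L x x = 0 :=
  (exteriorPower.ιMulti K 2).map_eq_zero_of_eq ![x, x] (i := 0) (j := 1) rfl (by decide)

variable {K L} in
theorem wedge_skew (x y : L) : wedge K L x y = -wedge K L y x := by
  have h := wedge_self (K := K) (x + y)
  simp only [map_add, LinearMap.add_apply, wedge_self, zero_add, add_zero] at h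
  exact eq_neg_of_add_eq_zero_right h

end Wedge

section Uce

variable (K : Type*) (L : Type*) [Field K] [AddCommGroup L] [Module K L] [HomLieAlgebra K L]

theorem fin_three_ne : (0 : Fin 3) ≠ 1 ∧ (0 : Fin 3) ≠ 2 ∧ (1 : Fin 3) ≠ 2 := by decide

theorem fin_three (i : Fin 3) : i = 0 ∨ i = 1 ∨ i = 2 := by
  revert i; decide

/-- The boundary `d₃ : ⋀³ L → ⋀² L` of the Hom-Lie homology complex with trivial coefficients:
`d₃ (x ∧ y ∧ z) = -[x, y] ∧ α z + [x, z] ∧ α y - [y, z] ∧ α x`. -/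
def d₃ : ⋀[K]^3 L →ₗ[K] ⋀[K]^2 L := exteriorPower.alternatingMapLinearEquiv
  { toFun := fun v => -wedge K L (br K (v 0) (v 1)) (al K (v 2))
      + wedge K L (br K (v 0) (v 2)) (al K (v 1))
      - wedge K L (br K (v 1) (v 2)) (al K (v 0))
    map_update_add' := by
      intro inst v i x y
      obtain ⟨h01, h02, h12⟩ := fin_three_ne
      rcases fin_three i with rfl | rfl | rfl <;>
        simp only [Function.update_self, Function.update_of_ne h01, Function.update_of_ne h02,
          Function.update_of_ne h12, Function.update_of_ne h01.symm,
          Function.update_of_ne h02.symm, Function.update_of_ne h12.symm,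
          map_add, LinearMap.add_apply] <;> abel
    map_update_smul' := by
      intro inst v i c x
      obtain ⟨h01, h02, h12⟩ := fin_three_ne
      rcases fin_three i with rfl | rfl | rfl <;>
        simp only [Function.update_self, Function.update_of_ne h01, Function.update_of_ne h02,
          Function.update_of_ne h12, Function.update_of_ne h01.symm,
          Function.update_of_ne h02.symm, Function.update_of_ne h12.symm,
          map_smul, LinearMap.smul_apply, smul_add, smul_sub, smul_neg]
    map_eq_zero_of_eq' := by
      intro v i j h hij
      have h10 : br K (v 1) (v 0) = -br K (v 0) (v 1) := br_skew K _ _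
      rcases fin_three i with rfl | rfl | rfl <;> rcases fin_three j with rfl | rfl | rfl <;>
        first
          | exact absurd rfl hij
          | (simp only [h, br_self, map_zero, LinearMap.zero_apply]
             try simp only [h] at h10
             try rw [br_skew K (v 1) (v 2)]
             try rw [br_skew K (v 0) (v 2)]
             simp [h10]) }

theorem d₃_apply (v : Fin 3 → L) : d₃ K L (exteriorPower.ιMulti K 3 v)
    = -wedge K L (br K (v 0) (v 1)) (al K (v 2)) + wedge K L (br K (v 0) (v 2)) (al K (v 1))
      - wedge K L (br K (v 1) (v 2)) (al K (v 0)) :=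
  exteriorPower.alternatingMapLinearEquiv_apply_ιMulti _ v

/-- The linear map `⋀² L → L`, `x ∧ y ↦ [x, y]`; up to sign, the boundary `d₂`. -/
def bracketMap : ⋀[K]^2 L →ₗ[K] L :=
  exteriorPower.alternatingMapLinearEquiv (altTwo (br K) (br_self K))

@[simp] theorem bracketMap_wedge (x y : L) : bracketMap K L (wedge K L x y) = br K x y :=
  exteriorPower.alternatingMapLinearEquiv_apply_ιMulti _ ![x, y]

/-- The vector space `𝔲𝔠𝔢(L) = ⋀² L / im d₃`. -/
def Uce : Type _ := (⋀[K]^2 L) ⧸ LinearMap.range (d₃ K L)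

namespace Uce

instance : AddCommGroup (Uce K L) :=
  inferInstanceAs (AddCommGroup ((⋀[K]^2 L) ⧸ LinearMap.range (d₃ K L)))
instance : Module K (Uce K L) :=
  inferInstanceAs (Module K ((⋀[K]^2 L) ⧸ LinearMap.range (d₃ K L)))

/-- The class `{x, y}` of `x ∧ y`, as a bilinear map. -/
def mk : L →ₗ[K] L →ₗ[K] Uce K L :=
  (wedge K L).compr₂ (Submodule.mkQ (LinearMap.range (d₃ K L)))

variable {K L} in
theorem mk_self (x : L) : mk K L x x = 0 := by
  change Submodule.mkQ (LinearMap.range (d₃ K L)) (wedge K L x x) = 0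
  rw [wedge_self, map_zero]

variable {K L} in
theorem mk_skew (x y : L) : mk K L x y = -mk K L y x := by
  change Submodule.mkQ (LinearMap.range (d₃ K L)) (wedge K L x y) = _
  rw [wedge_skew, map_neg]; rfl

variable {K L} in
theorem mk_cyc (x y z : L) : mk K L (br K x y) (al K z) + mk K L (br K z x) (al K y)
    + mk K L (br K y z) (al K x) = 0 := by
  have h : Submodule.mkQ (LinearMap.range (d₃ K L))
      (d₃ K L (exteriorPower.ιMulti K 3 ![x, y, z])) = 0 :=
    (Submodule.Quotient.mk_eq_zero _).2 ⟨_, rfl⟩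
  rw [d₃_apply] at h
  simp only [map_add, map_sub, map_neg] at h
  change -mk K L (br K x y) (al K z) + mk K L (br K x z) (al K y)
    - mk K L (br K y z) (al K x) = 0 at h
  rw [br_skew K x z, map_neg, LinearMap.neg_apply] at h
  rw [← neg_eq_zero, ← h]; abel

variable {K L} in
@[elab_as_elim]
theorem ind {P : Uce K L → Prop} (t : Uce K L) (mk : ∀ x y, P (mk K L x y))
    (add : ∀ s t, P s → P t → P (s + t)) : P t := by
  obtain ⟨t, rfl⟩ := Submodule.mkQ_surjective _ t
  have ht : t ∈ Submodule.span K (Set.range (exteriorPower.ιMulti K 2 (M := L))) := by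
    rw [exteriorPower.ιMulti_span]; trivial
  have hv (v : Fin 2 → L) : v = ![v 0, v 1] := by
    ext i; fin_cases i <;> rfl
  have h0 : P 0 := by
    have := mk 0 0
    rwa [map_zero] at this
  suffices h : ∀ c : K, P (c • Submodule.mkQ (LinearMap.range (d₃ K L)) t) by
    have := h 1
    rwa [one_smul] at this
  induction ht using Submodule.span_induction with
  | mem x hx =>
    obtain ⟨v, rfl⟩ := hx
    intro c
    have := mk (c • v 0) (v 1)
    rw [map_smul] at this
    rw [hv v]
    exact this
  | zero =>
    intro c
    rw [map_zero, smul_zero]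
    exact h0
  | add x y _ _ hx hy =>
    intro c
    rw [map_add, smul_add]
    exact add _ _ (hx c) (hy c)
  | smul d x _ hx =>
    intro c
    rw [map_smul, smul_smul]
    exact hx _

/-- The homomorphism `u : 𝔲𝔠𝔢(L) → L`, `{x, y} ↦ [x, y]`, as a linear map. -/
def uLin : Uce K L →ₗ[K] L :=
  Submodule.liftQ _ (bracketMap K L) (by
    rw [LinearMap.range_le_ker_iff]
    refine exteriorPower.linearMap_ext (AlternatingMap.ext fun v => ?_)
    change bracketMap K L (d₃ K L (exteriorPower.ιMulti K 3 v)) = 0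
    rw [d₃_apply]
    simp only [map_add, map_sub, map_neg, bracketMap_wedge]
    have h := jacobi K (v 0) (v 1) (v 2)
    rw [br_skew K (br K (v 0) (v 1)), br_skew K (br K (v 0) (v 2)),
      br_skew K (br K (v 1) (v 2)), br_skew K (v 0) (v 2), ← h]
    rw [map_neg]; abel)

@[simp] theorem uLin_mk (x y : L) : uLin K L (mk K L x y) = br K x y :=
  bracketMap_wedge K L x y

/-- The endomorphism of `𝔲𝔠𝔢(L)` induced by `α ∧ α`. -/
def alpha : Uce K L →ₗ[K] Uce K L :=
  Submodule.mapQ _ _ (exteriorPower.map 2 (al K)) (by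
    rintro _ ⟨t, rfl⟩
    refine ⟨exteriorPower.map 3 (al K) t, ?_⟩
    have h : d₃ K L ∘ₗ exteriorPower.map 3 (al K) = exteriorPower.map 2 (al K) ∘ₗ d₃ K L := by
      have hw (x y : L) : exteriorPower.map 2 (al K) (wedge K L x y)
          = wedge K L (al K x) (al K y) := by
        refine (exteriorPower.map_apply_ιMulti (al K) ![x, y]).trans
          (congrArg (exteriorPower.ιMulti K 2) ?_)
        funext i; fin_cases i <;> rfl
      refine exteriorPower.linearMap_ext (AlternatingMap.ext fun v => ?_)
      change d₃ K L (exteriorPower.map 3 (al K) (exteriorPower.ιMulti K 3 v))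
        = exteriorPower.map 2 (al K) (d₃ K L (exteriorPower.ιMulti K 3 v))
      rw [exteriorPower.map_apply_ιMulti, d₃_apply, d₃_apply]
      simp only [map_add, map_sub, map_neg, hw, al_br, Function.comp_apply]
    exact LinearMap.congr_fun h t)

@[simp] theorem alpha_mk (x y : L) : alpha K L (mk K L x y) = mk K L (al K x) (al K y) := by
  refine congrArg (Submodule.mkQ (LinearMap.range (d₃ K L)))
    ((exteriorPower.map_apply_ιMulti (al K) ![x, y]).trans
      (congrArg (exteriorPower.ιMulti K 2) ?_))
  funext i; fin_cases i <;> rfl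

/-- The bracket of `𝔲𝔠𝔢(L)`: `[{x₁, x₂}, {y₁, y₂}] = {[x₁, x₂], [y₁, y₂]}`. -/
def bracket : Uce K L →ₗ[K] Uce K L →ₗ[K] Uce K L := (mk K L).compl₁₂ (uLin K L) (uLin K L)

theorem bracket_apply (s t : Uce K L) : bracket K L s t = mk K L (uLin K L s) (uLin K L t) := rfl

theorem bracket_mk (x₁ x₂ y₁ y₂ : L) : bracket K L (mk K L x₁ x₂) (mk K L y₁ y₂)
    = mk K L (br K x₁ x₂) (br K y₁ y₂) := by
  rw [bracket_apply, uLin_mk, uLin_mk]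

theorem uLin_bracket (s t : Uce K L) :
    uLin K L (bracket K L s t) = br K (uLin K L s) (uLin K L t) := by
  rw [bracket_apply, uLin_mk]

theorem uLin_alpha (s : Uce K L) : uLin K L (alpha K L s) = al K (uLin K L s) := by
  induction s using ind with
  | mk x y => rw [alpha_mk, uLin_mk, uLin_mk, al_br]
  | add s t hs ht => simp only [map_add, hs, ht]

/-- `𝔲𝔠𝔢(L)` is a Hom-Lie algebra. -/
instance : HomLieAlgebra K (Uce K L) where
  bracket := bracket K L
  α := alpha K L
  bracket_self s := mk_self (uLin K L s)
  hom_jacobi s t r := by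
    change mk K L (uLin K L (alpha K L s)) (uLin K L (bracket K L t r))
      + mk K L (uLin K L (alpha K L r)) (uLin K L (bracket K L s t))
      + mk K L (uLin K L (alpha K L t)) (uLin K L (bracket K L r s)) = 0
    simp only [uLin_bracket, uLin_alpha]
    rw [mk_skew (al K (uLin K L s)), mk_skew (al K (uLin K L t)), mk_skew (al K (uLin K L r))]
    rw [← neg_eq_zero, ← mk_cyc (uLin K L s) (uLin K L t) (uLin K L r)]; abel
  α_bracket s t := by
    rw [bracket_apply, bracket_apply, alpha_mk, uLin_alpha, uLin_alpha]

/-- The homomorphism `u : 𝔲𝔠𝔢(L) → L`, `{x, y} ↦ [x, y]`. -/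
def u : Hom K (Uce K L) L where
  toLinearMap := uLin K L
  map_br := uLin_bracket K L
  map_al := uLin_alpha K L

end Uce

/-- The second homology `H₂^α(L) = ker d₂ / im d₃` with trivial coefficients, which is the kernel
of `u : 𝔲𝔠𝔢(L) = ⋀² L / im d₃ → L`, as a Hom-ideal of `𝔲𝔠𝔢(L)`. -/
def H₂ : Ideal K (Uce K L) := (Uce.u K L).ker

end Uce

end HomLie

end

/-! The carrying fact is that for a perfect Hom-Lie algebra `L` the tensor square `L ⋆ L` and
`𝔲𝔠𝔢(L)` are the same algebra, through `x ⋆ y ↔ {x, y}` (`Square.isoUce`). Both are quotients of `L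
⊗ L`: `𝔲𝔠𝔢(L)` by the alternating relations and the cyclic identity coming from `d₃`, and `L ⋆ L` by
the five tensor relations. The five relations always hold in `𝔲𝔠𝔢(L)`. Conversely, relations iii and
iv make `⋆` alternating on pairs of brackets, hence on all of `L` when `L` is perfect, and then
relation i becomes the cyclic identity. The Hom-Lie structures agree because each bracket depends
only on the values of its arguments under the commutator map to `L`.

Perfectness passes from `G` to `𝔲𝔠𝔢(G)` (`Uce.isPerfect`) and `𝔲𝔠𝔢` respects isomorphisms
(`Uce.mapIso`). Using the carrying fact for `G` and again for `𝔲𝔠𝔢(G)` gives `𝔲𝔠𝔢(G ⋆ G) ≅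
𝔲𝔠𝔢(𝔲𝔠𝔢(G)) ≅ 𝔲𝔠𝔢(G) ⋆ 𝔲𝔠𝔢(G)`. -/

noncomputable section

namespace HomLie

/-! ### Isomorphisms, and induction over brackets in a perfect algebra. -/

section Isomorphisms

variable {K L L' L'' : Type*} [Field K]
  [AddCommGroup L] [Module K L] [HomLieAlgebra K L]
  [AddCommGroup L'] [Module K L'] [HomLieAlgebra K L']
  [AddCommGroup L''] [Module K L''] [HomLieAlgebra K L'']

/-- The inverse of an isomorphism of Hom-Lie algebras. -/
def Iso.symm (e : Iso K L L') : Iso K L' L where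
  toLinearEquiv := e.toLinearEquiv.symm
  map_br x y := by
    rw [LinearEquiv.symm_apply_eq, e.map_br, LinearEquiv.apply_symm_apply,
      LinearEquiv.apply_symm_apply]
  map_al x := by
    rw [LinearEquiv.symm_apply_eq, e.map_al, LinearEquiv.apply_symm_apply]

/-- The composite of two isomorphisms of Hom-Lie algebras. -/
def Iso.trans (e : Iso K L L') (f : Iso K L' L'') : Iso K L L'' where
  toLinearEquiv := e.toLinearEquiv.trans f.toLinearEquiv
  map_br x y := by simp only [LinearEquiv.trans_apply, e.map_br, f.map_br]
  map_al x := by simp only [LinearEquiv.trans_apply, e.map_al, f.map_al]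

/-- The homomorphism underlying an isomorphism. -/
def Iso.toHom (e : Iso K L L') : Hom K L L' where
  toLinearMap := e.toLinearEquiv
  map_br := e.map_br
  map_al := e.map_al

/-- No scalar case is needed: a multiple of a bracket is again a bracket, so every element of a
perfect algebra is a finite sum of brackets. -/
theorem IsPerfect.induction (h : IsPerfect K L) {P : L → Prop}
    (br : ∀ x y, P (br K x y)) (add : ∀ x y, P x → P y → P (x + y)) (x : L) : P x := by
  have hx : x ∈ Submodule.span K {z : L | ∃ x y : L, z = HomLie.br K x y} := by
    rw [show Submodule.span K _ = ⊤ from h]; trivial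
  have h0 : P 0 := by simpa using br 0 0
  -- `P` is not assumed stable under scalars, so the span induction carries all multiples of `x` at
  -- once.
  suffices H : ∀ c : K, P (c • x) by simpa using H 1
  induction hx using Submodule.span_induction with
  | mem z hz =>
    obtain ⟨a, b, rfl⟩ := hz
    intro c
    -- The scalar is absorbed into the first argument of the bracket.
    simpa using br (c • a) b
  | zero => intro c; rwa [smul_zero]
  | add y z _ _ hy hz => intro c; rw [smul_add]; exact add _ _ (hy c) (hz c)
  | smul d y _ hy => intro c; rw [smul_smul]; exact hy _

end Isomorphisms

/-! ### Universal property, functoriality and perfectness of `𝔲𝔠𝔢`. -/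

namespace Uce

variable {K L L' : Type*} [Field K]
  [AddCommGroup L] [Module K L] [HomLieAlgebra K L]
  [AddCommGroup L'] [Module K L'] [HomLieAlgebra K L']

theorem br_def (s t : Uce K L) : br K s t = mk K L (uLin K L s) (uLin K L t) := rfl

theorem al_mk (x y : L) : al K (mk K L x y) = mk K L (al K x) (al K y) := alpha_mk K L x y

/-- Linear maps out of `𝔲𝔠𝔢(L)`, from alternating bilinear maps that vanish on `im d₃`. -/
def lift {P : Type*} [AddCommGroup P] [Module K P] (B : L →ₗ[K] L →ₗ[K] P)
    (hB : ∀ x, B x x = 0)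
    (hc : ∀ x y z, B (br K x y) (al K z) + B (br K z x) (al K y) + B (br K y z) (al K x) = 0) :
    Uce K L →ₗ[K] P :=
  Submodule.liftQ _ (exteriorPower.alternatingMapLinearEquiv (altTwo B hB)) (by
    have hw (x y : L) :
        exteriorPower.alternatingMapLinearEquiv (altTwo B hB) (wedge K L x y) = B x y :=
      exteriorPower.alternatingMapLinearEquiv_apply_ιMulti _ ![x, y]
    rw [LinearMap.range_le_ker_iff]
    refine exteriorPower.linearMap_ext (AlternatingMap.ext fun v => ?_)
    change exteriorPower.alternatingMapLinearEquiv (altTwo B hB)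
      (d₃ K L (exteriorPower.ιMulti K 3 v)) = 0
    rw [d₃_apply]
    simp only [map_add, map_sub, map_neg, hw]
    -- Once `[x, z]` is written as `-[z, x]`, the value of the map on `d₃ (x ∧ y ∧ z)` is minus the
    -- cyclic sum in `hc`.
    rw [br_skew K (v 0) (v 2), map_neg, LinearMap.neg_apply, ← neg_eq_zero,
      ← hc (v 0) (v 1) (v 2)]
    abel)

@[simp] theorem lift_mk {P : Type*} [AddCommGroup P] [Module K P] (B : L →ₗ[K] L →ₗ[K] P)
    (hB : ∀ x, B x x = 0)
    (hc : ∀ x y z, B (br K x y) (al K z) + B (br K z x) (al K y) + B (br K y z) (al K x) = 0)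
    (x y : L) : lift B hB hc (mk K L x y) = B x y :=
  exteriorPower.alternatingMapLinearEquiv_apply_ιMulti (altTwo B hB) ![x, y]

/-- The linear map `𝔲𝔠𝔢(L) → 𝔲𝔠𝔢(L')`, `{x, y} ↦ {f x, f y}`. -/
def mapLin (f : Hom K L L') : Uce K L →ₗ[K] Uce K L' :=
  lift ((mk K L').compl₁₂ f.toLinearMap f.toLinearMap) (fun x => by
    rw [LinearMap.compl₁₂_apply, mk_self]) (fun x y z => by
    simp only [LinearMap.compl₁₂_apply, f.map_br, f.map_al]
    exact mk_cyc _ _ _)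

@[simp] theorem mapLin_mk (f : Hom K L L') (x y : L) :
    mapLin f (mk K L x y) = mk K L' (f.toLinearMap x) (f.toLinearMap y) :=
  lift_mk _ _ _ x y

/-- Naturality of `u`. Since the bracket of `𝔲𝔠𝔢` is `[s, t] = {u s, u t}`, this is what makes the
induced map preserve brackets. -/
theorem uLin_mapLin (f : Hom K L L') (s : Uce K L) :
    uLin K L' (mapLin f s) = f.toLinearMap (uLin K L s) := by
  induction s using ind with
  | mk x y => rw [mapLin_mk, uLin_mk, uLin_mk, f.map_br]
  | add s t hs ht => simp only [map_add, hs, ht]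

/-- Isomorphic Hom-Lie algebras have isomorphic `𝔲𝔠𝔢`. -/
def mapIso (e : Iso K L L') : Iso K (Uce K L) (Uce K L') where
  toLinearEquiv := LinearEquiv.ofLinearMap (mapLin e.toHom) (mapLin e.symm.toHom)
    (LinearMap.ext fun s => by
      induction s using ind with
      | mk x y =>
        simp only [LinearMap.comp_apply, mapLin_mk, LinearMap.id_apply]
        exact congrArg₂ (fun a b => mk K L' a b) (e.toLinearEquiv.apply_symm_apply x)
          (e.toLinearEquiv.apply_symm_apply y)
      | add s t hs ht => rw [map_add, hs, ht, map_add])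
    (LinearMap.ext fun s => by
      induction s using ind with
      | mk x y =>
        simp only [LinearMap.comp_apply, mapLin_mk, LinearMap.id_apply]
        exact congrArg₂ (fun a b => mk K L a b) (e.toLinearEquiv.symm_apply_apply x)
          (e.toLinearEquiv.symm_apply_apply y)
      | add s t hs ht => rw [map_add, hs, ht, map_add])
  map_br s t := by
    change mapLin e.toHom (br K s t) = br K (mapLin e.toHom s) (mapLin e.toHom t)
    rw [br_def, br_def, mapLin_mk, uLin_mapLin, uLin_mapLin]
  map_al s := by
    change mapLin e.toHom (al K s) = al K (mapLin e.toHom s)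
    induction s using ind with
    | mk x y => rw [al_mk, mapLin_mk, mapLin_mk, al_mk, e.toHom.map_al, e.toHom.map_al]
    | add s t hs ht => simp only [map_add, hs, ht]

/-- `𝔲𝔠𝔢(L)` is perfect if `L` is. -/
theorem isPerfect (h : IsPerfect K L) : IsPerfect K (Uce K L) := by
  refine Submodule.eq_top_iff'.2 fun s => ?_
  induction s using ind with
  | add s t hs ht => exact Submodule.add_mem _ hs ht
  | mk x y =>
    induction x using h.induction with
    | add a b ha hb => rw [map_add, LinearMap.add_apply]; exact Submodule.add_mem _ ha hb
    | br a a' =>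
      induction y using h.induction with
      | add c d hc hd => rw [map_add]; exact Submodule.add_mem _ hc hd
      | br b b' =>
        -- With both entries reduced to brackets, `{[a, a'], [b, b']}` is the bracket of `{a, a'}`
        -- and `{b, b'}`.
        exact Submodule.subset_span ⟨mk K L a a', mk K L b b',
          (bracket_mk K L _ _ _ _).symm⟩

end Uce

/-! ### Comparison of `L ⋆ L` with `𝔲𝔠𝔢(L)` for perfect `L`. -/

namespace Square

variable {K L : Type*} [Field K] [AddCommGroup L] [Module K L] [HomLieAlgebra K L]

/-- Relation iv is skew-symmetry, but only for pairs of brackets; perfectness and bilinearity extend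
it to all pairs. -/
theorem mk_skew (h : IsPerfect K L) (x y : L) :
    Star.mk (CompatibleActions.self K L) x y = -Star.mk (CompatibleActions.self K L) y x := by
  induction x using h.induction with
  | add a b ha hb => simp only [map_add, LinearMap.add_apply, ha, hb, neg_add]
  | br a a' =>
    induction y using h.induction with
    | add c d hc hd => simp only [map_add, LinearMap.add_apply, hc, hd, neg_add]
    | br b b' =>
      have hr : Star.mk (CompatibleActions.self K L) (br K a a') (br K b' b)
          + Star.mk (CompatibleActions.self K L) (br K b b') (br K a' a) = 0 :=
        -- The arguments are ordered so that `ⁿm = [a, a']` and `ⁿ'm' = [b, b']`; the other two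
        -- factors are these brackets reversed, so both terms carry the same sign.
        Star.rel_iv a' b' a b
      rw [br_skew K b' b, br_skew K a' a, map_neg, map_neg, ← neg_add, neg_eq_zero] at hr
      exact eq_neg_of_add_eq_zero_left hr

/-- On a single bracket this is relation iii, which is needed separately because skew-symmetry does
not imply it in characteristic 2. For a sum, the cross terms cancel by `mk_skew`. -/
theorem mk_self (h : IsPerfect K L) (x : L) :
    Star.mk (CompatibleActions.self K L) x x = 0 := by
  induction x using h.induction with
  | br a b =>
    have hr : Star.mk (CompatibleActions.self K L) (br K a b) (br K b a) = 0 :=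
      Star.rel_iii b a
    rwa [br_skew K b a, map_neg, neg_eq_zero] at hr
  | add a b ha hb =>
    rw [map_add, map_add, LinearMap.add_apply, LinearMap.add_apply, ha, hb, mk_skew h a b]
    abel

/-- Relation i contains the same three terms, two of them with their tensor factors interchanged;
`mk_skew` puts them in order. -/
theorem mk_cyc (h : IsPerfect K L) (x y z : L) :
    Star.mk (CompatibleActions.self K L) (br K x y) (al K z)
      + Star.mk (CompatibleActions.self K L) (br K z x) (al K y)
      + Star.mk (CompatibleActions.self K L) (br K y z) (al K x) = 0 := by
  have hr : Star.mk (CompatibleActions.self K L) (br K x y) (al K z)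
      - Star.mk (CompatibleActions.self K L) (al K x) (br K y z)
      + Star.mk (CompatibleActions.self K L) (al K y) (br K x z) = 0 := Star.rel_i x y z
  rw [mk_skew h (al K x), mk_skew h (al K y), br_skew K x z, map_neg, LinearMap.neg_apply] at hr
  rw [← hr]; abel

variable (K L) in
/-- The linear map `L ⋆ L → 𝔲𝔠𝔢(L)`, `x ⋆ y ↦ {x, y}`. -/
def toUce : Square K L →ₗ[K] Uce K L := Star.lift (Uce.mk K L) (by
  -- Up to sign, relations i and ii become the cyclic identity on their three entries, iii and iv
  -- follow from `{x, y}` being alternating, and v is the cyclic identity for the brackets `[n, m]`,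
  -- `[n', m']`, `[n'', m'']`. Perfectness plays no role in this direction.
  rintro _ (⟨m, m', n⟩ | ⟨m, n, n'⟩ | ⟨m, n⟩ | ⟨m, m', n, n'⟩ | ⟨m, m', m'', n, n', n''⟩) <;>
    simp only [map_add, map_sub, TensorProduct.lift.tmul] <;>
    simp only [CompatibleActions.self]
  · rw [← Uce.mk_cyc m m' n, Uce.mk_skew (al K m), Uce.mk_skew (al K m'), br_skew K n m,
      map_neg, LinearMap.neg_apply]
    abel
  · rw [← neg_eq_zero, ← Uce.mk_cyc m n n', Uce.mk_skew (al K m), br_skew K m n,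
      map_neg, LinearMap.neg_apply]
    abel
  · rw [br_skew K n m, map_neg, LinearMap.neg_apply, Uce.mk_self, neg_zero]
  · rw [br_skew K m' n', br_skew K m n, map_neg, map_neg, Uce.mk_skew (br K n' m')]
    abel
  · rw [br_skew K m'' n'', br_skew K m n, br_skew K m' n']
    simp only [map_neg]
    rw [← neg_eq_zero, ← Uce.mk_cyc (br K n m) (br K n' m') (br K n'' m'')]
    abel)

@[simp] theorem toUce_mk (x y : L) : toUce K L (Star.mk _ x y) = Uce.mk K L x y :=
  Star.lift_mk _ _ x y

theorem uLin_toUce (s : Square K L) :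
    Uce.uLin K L (toUce K L s) = Star.toN (CompatibleActions.self K L) s := by
  induction s using Star.ind with
  | zero => simp
  | mk x y => rw [toUce_mk, Uce.uLin_mk, Star.toN_mk]; rfl
  | add s t hs ht => simp only [map_add, hs, ht]

/-- Since `-[y, x] = [x, y]`, the two projections are one commutator map. The bracket of `L ⋆ L`
thus has the same shape as `{u s, u t}`. -/
theorem toM_eq_toN (s : Square K L) :
    Star.toM (CompatibleActions.self K L) s = Star.toN (CompatibleActions.self K L) s := by
  induction s using Star.ind with
  | zero => simp
  | mk x y => rw [Star.toM_mk, Star.toN_mk]; exact (br_skew K x y).symm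
  | add s t hs ht => simp only [map_add, hs, ht]

/-- For perfect `L`, the tensor square `L ⋆ L` is isomorphic to `𝔲𝔠𝔢(L)`. -/
def isoUce (h : IsPerfect K L) : Iso K (Square K L) (Uce K L) where
  toLinearEquiv := LinearEquiv.ofLinearMap (toUce K L)
    -- Perfectness enters here, in making the inverse `{x, y} ↦ x ⋆ y` well defined.
    (Uce.lift (Star.mk (CompatibleActions.self K L)) (mk_self h) (mk_cyc h))
    (LinearMap.ext fun s => by
      induction s using Uce.ind with
      | mk x y => rw [LinearMap.comp_apply, Uce.lift_mk, toUce_mk, LinearMap.id_apply]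
      | add s t hs ht => rw [map_add, hs, ht, map_add])
    (LinearMap.ext fun s => by
      induction s using Star.ind with
      | zero => simp
      | mk x y => rw [LinearMap.comp_apply, toUce_mk, Uce.lift_mk, LinearMap.id_apply]
      | add s t hs ht => rw [map_add, hs, ht, map_add])
  map_br s t := by
    change toUce K L (br K s t) = br K (toUce K L s) (toUce K L t)
    rw [Star.br_def, Uce.br_def, toUce_mk, uLin_toUce, uLin_toUce, toM_eq_toN]
  map_al s := by
    change toUce K L (al K s) = al K (toUce K L s)
    induction s using Star.ind with
    | zero => simp
    | mk x y => rw [Star.al_def, Star.alpha_mk, toUce_mk, toUce_mk, Uce.al_mk]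
    | add s t hs ht => simp only [map_add, hs, ht]

end Square

end HomLie

end

theorem corollary6p7 {K : Type*} {G : Type*} [Field K] [AddCommGroup G] [Module K G]
    [HomLie.HomLieAlgebra K G]
    (hperfect : HomLie.IsPerfect K G)
    (hα : Function.Surjective (HomLie.al K : G →ₗ[K] G))
    (hH₂ : Nonempty (HomLie.Iso K
      (HomLie.H₂ K (HomLie.Square K G)).toSubmodule
      (HomLie.eta (HomLie.H₂ K G)).range.toSubmodule)) :
    Nonempty (HomLie.Iso K
      (HomLie.Uce K (HomLie.Square K G))
      (HomLie.Square K (HomLie.Uce K G))) :=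
  -- The intermediate algebra is `𝔲𝔠𝔢(𝔲𝔠𝔢(G))`; the second factor is the comparison for the perfect
  -- algebra `𝔲𝔠𝔢(G)`, read backwards.
  ⟨(HomLie.Uce.mapIso (HomLie.Square.isoUce hperfect)).trans
    (HomLie.Square.isoUce (HomLie.Uce.isPerfect hperfect)).symm⟩
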